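/- A $C^*$-Eberlein algebra is a quadruple $(A,\Phi,V,H)$ where $A$ is a $C^*$-algebra, $H$ is a Hilbert space, $\Phi:A\to A^{**}\bar\otimes A^{**}$ is a unital $*$-homomorphism into the von Neumann algebra tensor product, and $V\in A^{**}\bar\otimes\mathcal B(H)$ is a contraction, such that: (1) $A_V=\{(\mathrm{id}\otimes\omega)(V):\omega\in\mathcal B(H)_*\}$ is a subset of $A\subseteq A^{**}$ and is norm dense in $A$; (2) the bilinear product on $A^*$ given by $\langle\mu\star\nu,a\rangle=\langle\Phi(a),\mu\otimes\nu\rangle$ is associative; (3) the map $A^*\to\mathcal B(H)$, $\mu\mapsto(\mu\otimes\mathrm{id})(V)$, is a homomorphism for the product $\star$. For $a\in A$ and $\mu\in A^*$ let $a\cdot\mu\in A^{**}$ be given by $\langle a\cdot\mu,\nu\rangle=\langle \mu\star\nu,a\rangle$ for $\nu\in A^*$. When $A$ is unital, a left invariant mean on $A$ is a state $M\in A^*$ such that $\langle M,a\cdot\mu\rangle=\langle M,a\rangle$ for all $a\in A$ and all states $\mu\in A^*$. Theorem. Let $(A,\Phi,V,H)$ be a $C^*$-Eberlein algebra with $A$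 unital and $A\neq 0$. Then $A$ has a left invariant mean. -/

import Mathlib

open scoped ComplexOrder InnerProductSpace TensorProduct ENNReal

noncomputable section

namespace EberleinAlg

universe u v w

/-! ### Von Neumann algebras and their tensor products -/

section VonNeumann

variable {H : Type v} [NormedAddCommGroup H] [InnerProductSpace ℂ H] [CompleteSpace H]
  {K : Type w} [NormedAddCommGroup K] [InnerProductSpace ℂ K] [CompleteSpace K]

/-- The von Neumann algebra on `H` generated by a set `S` of operators: the double commutant
of `S ∪ S*`. -/
def vnGenerated (S : Set (H →L[ℂ] H)) : VonNeumannAlgebra H where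
  toStarSubalgebra :=
    StarSubalgebra.centralizer ℂ (StarSubalgebra.centralizer ℂ S : Set (H →L[ℂ] H))
  centralizer_centralizer' := by
    change Set.centralizer (Set.centralizer
      (StarSubalgebra.centralizer ℂ (StarSubalgebra.centralizer ℂ S : Set (H →L[ℂ] H)) :
        Set (H →L[ℂ] H))) = _
    rw [StarSubalgebra.coe_centralizer_centralizer, Set.centralizer_centralizer_centralizer]
    exact (StarSubalgebra.coe_centralizer_centralizer ℂ S).symm

variable (H) in
/-- `B(H)` as a von Neumann algebra on `H`. -/
def vnFull : VonNeumannAlgebra H where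
  toStarSubalgebra := ⊤
  centralizer_centralizer' :=
    Set.Subset.antisymm (Set.subset_univ _) Set.subset_centralizer_centralizer

variable (H K) in
/-- The Hilbert space tensor product: the completion of the algebraic tensor product. -/
abbrev HTensor : Type (max v w) := UniformSpace.Completion (H ⊗[ℂ] K)

/-- The operator `x ⊗ y` on the Hilbert space tensor product. -/
def opTensor (x : H →L[ℂ] H) (y : K →L[ℂ] K) : HTensor H K →L[ℂ] HTensor H K :=
  (TensorProduct.mapL x y).completion

/-- The von Neumann algebra tensor product of `M` and `N`: the von Neumann algebra on the
Hilbert space tensor product generated by all `x ⊗ y` with `x ∈ M`, `y ∈ N`. -/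
def vnTensor (M : VonNeumannAlgebra H) (N : VonNeumannAlgebra K) :
    VonNeumannAlgebra (HTensor H K) :=
  vnGenerated {z | ∃ x ∈ M, ∃ y ∈ N, z = opTensor x y}

variable (H K) in
/-- The bounded map `ξ ↦ (α ↦ ξ ⊗ α)` from `H` to the operators `K → H ⊗ K`. -/
def ketLeft : H →L[ℂ] K →L[ℂ] HTensor H K :=
  (ContinuousLinearMap.compL ℂ K (H ⊗[ℂ] K) (HTensor H K)
    UniformSpace.Completion.toComplL).comp (TensorProduct.mkL ℂ H K)

variable (H K) in
/-- The bounded map `α ↦ (ξ ↦ ξ ⊗ α)` from `K` to the operators `H → H ⊗ K`. -/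
def ketRight : K →L[ℂ] H →L[ℂ] HTensor H K := (ketLeft H K).flip

/-- A bounded functional on `B(H)` is normal, that is, belongs to the predual `B(H)_*`, if it is
of the form `x ↦ ∑ₙ (x ξₙ | ηₙ)` with `∑ ‖ξₙ‖² < ∞` and `∑ ‖ηₙ‖² < ∞`. -/
def IsNormal (f : StrongDual ℂ (H →L[ℂ] H)) : Prop :=
  ∃ ξ η : ℕ → H, Summable (fun n => ‖ξ n‖ ^ 2) ∧ Summable (fun n => ‖η n‖ ^ 2) ∧
    ∀ x : H →L[ℂ] H, HasSum (fun n => ⟪η n, x (ξ n)⟫_ℂ) (f x)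

end VonNeumann

/-! ### Slice maps -/

section Slice

variable {E : Type u} [NormedAddCommGroup E] [InnerProductSpace ℂ E] [CompleteSpace E]
  {F : Type v} [NormedAddCommGroup F] [InnerProductSpace ℂ F]
  {G : Type w} [NormedAddCommGroup G] [InnerProductSpace ℂ G] [CompleteSpace G]

theorem norm_sliceForm_le (J : F →L[ℂ] E →L[ℂ] G) (f : StrongDual ℂ (E →L[ℂ] E))
    (X : G →L[ℂ] G) (β α : F) :
    ‖f (ContinuousLinearMap.adjoint (J β) ∘L X ∘L J α)‖ ≤
      ‖f‖ * (‖J‖ * ‖J‖) * ‖X‖ * ‖β‖ * ‖α‖ := by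
  have h1 : ‖ContinuousLinearMap.adjoint (J β) ∘L X ∘L J α‖ ≤
      (‖J‖ * ‖β‖) * (‖X‖ * (‖J‖ * ‖α‖)) := by
    refine (ContinuousLinearMap.opNorm_comp_le _ _).trans ?_
    rw [LinearIsometryEquiv.norm_map]
    gcongr
    · exact J.le_opNorm β
    · refine (ContinuousLinearMap.opNorm_comp_le _ _).trans ?_
      gcongr
      exact J.le_opNorm α
  calc ‖f (ContinuousLinearMap.adjoint (J β) ∘L X ∘L J α)‖
      ≤ ‖f‖ * ‖ContinuousLinearMap.adjoint (J β) ∘L X ∘L J α‖ := f.le_opNorm _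
    _ ≤ ‖f‖ * ((‖J‖ * ‖β‖) * (‖X‖ * (‖J‖ * ‖α‖))) := by gcongr
    _ = ‖f‖ * (‖J‖ * ‖J‖) * ‖X‖ * ‖β‖ * ‖α‖ := by ring

/-- The sesquilinear form `(β, α) ↦ f ((J β)* X (J α))` on `F`. -/
def sliceForm (J : F →L[ℂ] E →L[ℂ] G) (f : StrongDual ℂ (E →L[ℂ] E)) (X : G →L[ℂ] G) :
    F →L⋆[ℂ] F →L[ℂ] ℂ :=
  LinearMap.mkContinuous₂
    (LinearMap.mk₂'ₛₗ (starRingEnd ℂ) (RingHom.id ℂ)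
      (fun β α => f (ContinuousLinearMap.adjoint (J β) ∘L X ∘L J α))
      (fun β β' α => by simp [ContinuousLinearMap.add_comp])
      (fun c β α => by
        rw [map_smul, LinearIsometryEquiv.map_smulₛₗ, ContinuousLinearMap.smul_comp, map_smul])
      (fun β α α' => by simp [ContinuousLinearMap.comp_add])
      (fun c β α => by simp))
    (‖f‖ * (‖J‖ * ‖J‖) * ‖X‖) (norm_sliceForm_le J f X)

variable [CompleteSpace F]

/-- The operator on `F` with matrix coefficients `f ((J β)* X (J α))`; see `inner_sliceOp`. -/
def sliceOp (J : F →L[ℂ] E →L[ℂ] G) (f : StrongDual ℂ (E →L[ℂ] E)) (X : G →L[ℂ] G) :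
    F →L[ℂ] F :=
  ContinuousLinearMap.adjoint (InnerProductSpace.continuousLinearMapOfBilin (sliceForm J f X))

theorem inner_sliceOp (J : F →L[ℂ] E →L[ℂ] G) (f : StrongDual ℂ (E →L[ℂ] E)) (X : G →L[ℂ] G)
    (α β : F) :
    ⟪β, sliceOp J f X α⟫_ℂ = f (ContinuousLinearMap.adjoint (J β) ∘L X ∘L J α) := by
  rw [sliceOp, ContinuousLinearMap.adjoint_inner_right,
    InnerProductSpace.continuousLinearMapOfBilin_apply]
  rfl

theorem norm_sliceOp_le (J : F →L[ℂ] E →L[ℂ] G) (f : StrongDual ℂ (E →L[ℂ] E))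
    (X : G →L[ℂ] G) : ‖sliceOp J f X‖ ≤ ‖f‖ * (‖J‖ * ‖J‖) * ‖X‖ := by
  refine ContinuousLinearMap.opNorm_le_of_re_inner_le (𝕜 := ℂ) (by positivity) fun α β hα hβ => ?_
  refine (RCLike.re_le_norm _).trans ?_
  rw [norm_inner_symm, inner_sliceOp]
  simpa [hα, hβ] using norm_sliceForm_le J f X β α

/-- `sliceOp` as a bounded linear map in the operator that is sliced. -/
def sliceL (J : F →L[ℂ] E →L[ℂ] G) (f : StrongDual ℂ (E →L[ℂ] E)) :
    (G →L[ℂ] G) →L[ℂ] (F →L[ℂ] F) :=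
  LinearMap.mkContinuous
    { toFun := sliceOp J f
      map_add' := fun X Y => by
        ext α
        refine ext_inner_left ℂ fun β => ?_
        simp [inner_sliceOp, inner_add_right, ContinuousLinearMap.add_comp,
          ContinuousLinearMap.comp_add]
      map_smul' := fun c X => by
        ext α
        refine ext_inner_left ℂ fun β => ?_
        simp [inner_sliceOp, inner_smul_right, ContinuousLinearMap.smul_comp] }
    (‖f‖ * (‖J‖ * ‖J‖)) (norm_sliceOp_le J f)

variable {H : Type v} [NormedAddCommGroup H] [InnerProductSpace ℂ H] [CompleteSpace H]
  {K : Type w} [NormedAddCommGroup K] [InnerProductSpace ℂ K] [CompleteSpace K]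

/-- The slice map `f ⊗ id : B(H ⊗ K) → B(K)` of a normal functional `f` on `B(H)`:
`((f ⊗ id)(X) α | β) = f (X_{α,β})`, where `X_{α,β} ∈ B(H)` is given by
`(X_{α,β} ξ | η) = (X (ξ ⊗ α) | η ⊗ β)`. -/
def sliceLeft (f : StrongDual ℂ (H →L[ℂ] H)) :
    (HTensor H K →L[ℂ] HTensor H K) →L[ℂ] (K →L[ℂ] K) :=
  sliceL (ketRight H K) f

/-- The slice map `id ⊗ g : B(H ⊗ K) → B(H)` of a normal functional `g` on `B(K)`:
`((id ⊗ g)(X) ξ | η) = g (X^{ξ,η})`, where `X^{ξ,η} ∈ B(K)` is given by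
`(X^{ξ,η} α | β) = (X (ξ ⊗ α) | η ⊗ β)`. -/
def sliceRight (g : StrongDual ℂ (K →L[ℂ] K)) :
    (HTensor H K →L[ℂ] HTensor H K) →L[ℂ] (H →L[ℂ] H) :=
  sliceL (ketLeft H K) g

/-- The functional `f ⊗ g` on `B(H ⊗ K)`, for normal functionals `f` and `g`. -/
def tensorFunctional (f : StrongDual ℂ (H →L[ℂ] H)) (g : StrongDual ℂ (K →L[ℂ] K)) :
    StrongDual ℂ (HTensor H K →L[ℂ] HTensor H K) :=
  g ∘L sliceLeft f

end Slice

/-! ### Direct sums of representations -/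

section DirectSum

variable {A : Type u} [CStarAlgebra A]

/-- A `*`-representation of `A` on a Hilbert space, as a bounded linear map. -/
def repL {L : Type v} [NormedAddCommGroup L] [InnerProductSpace ℂ L] [CompleteSpace L]
    (π : A →⋆ₐ[ℂ] (L →L[ℂ] L)) : A →L[ℂ] (L →L[ℂ] L) :=
  LinearMap.mkContinuous
    { toFun := fun a => π a
      map_add' := map_add π
      map_smul' := map_smul π } 1
    (fun a => by rw [one_mul]; exact NonUnitalStarAlgHom.norm_apply_le π a)

variable {ι : Type w} {E : ι → Type v} [∀ i, NormedAddCommGroup (E i)]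
  [∀ i, InnerProductSpace ℂ (E i)] [∀ i, CompleteSpace (E i)]
  (π : ∀ i, A →⋆ₐ[ℂ] (E i →L[ℂ] E i))

theorem norm_rep_apply_le (i : ι) (a : A) (x : E i) : ‖π i a x‖ ≤ ‖a‖ * ‖x‖ := by
  refine (ContinuousLinearMap.le_opNorm _ _).trans ?_
  gcongr
  exact NonUnitalStarAlgHom.norm_apply_le (π i) a

theorem memℓp_rep (a : A) (x : lp E 2) : Memℓp (fun i => π i a (x i)) 2 := by
  have hx := (lp.memℓp x).summable (by norm_num)
  refine memℓp_gen ?_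
  refine Summable.of_nonneg_of_le (fun i => by positivity) (fun i => ?_)
    (hx.mul_left (‖a‖ ^ (2 : ℝ≥0∞).toReal))
  rw [← Real.mul_rpow (norm_nonneg _) (norm_nonneg _)]
  exact Real.rpow_le_rpow (norm_nonneg _) (norm_rep_apply_le π i a (x i)) (by norm_num)

/-- The operator `⊕ πᵢ(a)` on the Hilbert sum of the spaces `E i`. -/
def directSumOp (a : A) : lp E 2 →L[ℂ] lp E 2 :=
  LinearMap.mkContinuous
    { toFun := fun x => ⟨fun i => π i a (x i), memℓp_rep π a x⟩
      map_add' := fun x y => by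
        ext i
        simp only [lp.coeFn_add, Pi.add_apply, map_add]
      map_smul' := fun c x => by
        ext i
        simp only [lp.coeFn_smul, Pi.smul_apply, map_smul, RingHom.id_apply] }
    ‖a‖
    (fun x => by
      have hs := (lp.memℓp x).summable (by norm_num)
      refine lp.norm_le_of_tsum_le (by norm_num) (by positivity) ?_
      rw [Real.mul_rpow (norm_nonneg _) (norm_nonneg _),
        lp.norm_rpow_eq_tsum (by norm_num) x, ← tsum_mul_left]
      refine ((memℓp_rep π a x).summable (by norm_num)).tsum_le_tsum (fun i => ?_)
        (hs.mul_left _)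
      rw [← Real.mul_rpow (norm_nonneg _) (norm_nonneg _)]
      exact Real.rpow_le_rpow (norm_nonneg _) (norm_rep_apply_le π i a (x i)) (by norm_num))

theorem directSumOp_apply (a : A) (x : lp E 2) (i : ι) :
    directSumOp π a x i = π i a (x i) := rfl

/-- The direct sum of a family of `*`-representations. -/
def directSumRep : A →⋆ₐ[ℂ] (lp E 2 →L[ℂ] lp E 2) where
  toFun := directSumOp π
  map_one' := by ext x i; simp [directSumOp_apply]
  map_mul' a b := by ext x i; simp [directSumOp_apply]
  map_zero' := by ext x i; simp [directSumOp_apply]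
  map_add' a b := by ext x i; simp [directSumOp_apply]
  commutes' c := by ext x i; simp [directSumOp_apply, Algebra.algebraMap_eq_smul_one]
  map_star' a := by
    refine (ContinuousLinearMap.eq_adjoint_iff _ _).2 fun x y => ?_
    rw [lp.inner_eq_tsum, lp.inner_eq_tsum]
    refine tsum_congr fun i => ?_
    simp only [directSumOp_apply, map_star, ContinuousLinearMap.star_eq_adjoint,
      ContinuousLinearMap.adjoint_inner_left]

end DirectSum

/-! ### The universal representation and the enveloping von Neumann algebra -/

section Universal

variable (A : Type u) [CStarAlgebra A] [PartialOrder A] [StarOrderedRing A]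

/-- The Hilbert space of the universal representation: the Hilbert sum of the GNS spaces of all
states of `A`. -/
def UnivSpace : Type u := lp (fun φ : {φ : A →ₚ[ℂ] ℂ // φ 1 = 1} => φ.1.GNS) 2

instance : NormedAddCommGroup (UnivSpace A) :=
  inferInstanceAs (NormedAddCommGroup (lp (fun φ : {φ : A →ₚ[ℂ] ℂ // φ 1 = 1} => φ.1.GNS) 2))

instance : InnerProductSpace ℂ (UnivSpace A) :=
  inferInstanceAs (InnerProductSpace ℂ (lp (fun φ : {φ : A →ₚ[ℂ] ℂ // φ 1 = 1} => φ.1.GNS) 2))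

instance : CompleteSpace (UnivSpace A) :=
  inferInstanceAs (CompleteSpace (lp (fun φ : {φ : A →ₚ[ℂ] ℂ // φ 1 = 1} => φ.1.GNS) 2))

/-- The universal representation of `A`, the direct sum of the GNS representations of all
states. -/
def univRep : A →⋆ₐ[ℂ] (UnivSpace A →L[ℂ] UnivSpace A) :=
  directSumRep (E := fun φ : {φ : A →ₚ[ℂ] ℂ // φ 1 = 1} => φ.1.GNS)
    (fun φ => φ.1.gnsStarAlgHom)

/-- The bidual `A**`, realised as the enveloping von Neumann algebra of `A`: the von Neumann
algebra generated by `A` in its universal representation. -/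
def bidualVN : VonNeumannAlgebra (UnivSpace A) := vnGenerated (Set.range (univRep A))

variable {A}

open Classical in
/-- The normal extension of `μ ∈ A*` to `A**`: a normal functional on the operators on the
universal Hilbert space which restricts to `μ` on `A`. Such a functional always exists (`μ` is a
linear combination of states, and each state is a vector state in the universal representation),
and its restriction to `A**` is unique; it is only applied to `A**`, and its slice maps only to
tensor products of `A**` with another von Neumann algebra. -/
def normalExt (μ : StrongDual ℂ A) : StrongDual ℂ (UnivSpace A →L[ℂ] UnivSpace A) :=
  if h : ∃ f : StrongDual ℂ (UnivSpace A →L[ℂ] UnivSpace A),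
      IsNormal f ∧ ∀ a : A, f (univRep A a) = μ a
  then h.choose else 0

/-- `μ ∈ A*` is a state: a positive functional with `μ(1) = 1`. -/
def IsState (μ : StrongDual ℂ A) : Prop := μ 1 = 1 ∧ ∀ a : A, 0 ≤ a → 0 ≤ μ a

end Universal

/-! ### C*-Eberlein algebras and means -/

section Eberlein

variable {A : Type u} [CStarAlgebra A] [PartialOrder A] [StarOrderedRing A]

/-- The product `μ ⋆ ν` on `A*` induced by `Φ`: `⟨μ ⋆ ν, a⟩ = ⟨Φ(a), μ ⊗ ν⟩`. -/
def conv (Φ : A →⋆ₐ[ℂ] (HTensor (UnivSpace A) (UnivSpace A) →L[ℂ]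
      HTensor (UnivSpace A) (UnivSpace A))) (μ ν : StrongDual ℂ A) : StrongDual ℂ A :=
  tensorFunctional (normalExt μ) (normalExt ν) ∘L
    repL Φ

/-- A (unital) C*-Eberlein algebra `(A, Φ, V, H)`, where `A` is a unital C*-algebra and `H` is a
Hilbert space. -/
structure CStarEberlein (A : Type u) [CStarAlgebra A] [PartialOrder A] [StarOrderedRing A]
    (H : Type v) [NormedAddCommGroup H] [InnerProductSpace ℂ H] [CompleteSpace H] where
  /-- The unital `*`-homomorphism `Φ` from `A` to `A** ⊗ A**` (von Neumann tensor product). -/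
  Φ : A →⋆ₐ[ℂ] (HTensor (UnivSpace A) (UnivSpace A) →L[ℂ] HTensor (UnivSpace A) (UnivSpace A))
  Φ_mem : ∀ a, Φ a ∈ vnTensor (bidualVN A) (bidualVN A)
  /-- The contraction `V` in `A** ⊗ B(H)` (von Neumann tensor product). -/
  V : HTensor (UnivSpace A) H →L[ℂ] HTensor (UnivSpace A) H
  V_mem : V ∈ vnTensor (bidualVN A) (vnFull H)
  norm_V_le : ‖V‖ ≤ 1
  /-- `(id ⊗ ω)(V) ∈ A ⊆ A**` for all `ω ∈ B(H)_*`. -/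
  slice_mem : ∀ ω : StrongDual ℂ (H →L[ℂ] H), IsNormal ω →
    sliceRight ω V ∈ Set.range (univRep A)
  /-- The elements `(id ⊗ ω)(V)`, `ω ∈ B(H)_*`, form a norm dense subset of `A`. -/
  slice_dense : Dense {a : A | ∃ ω : StrongDual ℂ (H →L[ℂ] H), IsNormal ω ∧
    univRep A a = sliceRight ω V}
  /-- The product on `A*` is associative. -/
  conv_assoc : ∀ μ ν ρ : StrongDual ℂ A, conv Φ (conv Φ μ ν) ρ = conv Φ μ (conv Φ ν ρ)
  /-- The map `μ ↦ (μ ⊗ id)(V)` is multiplicative on `A*`. -/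
  slice_conv : ∀ μ ν : StrongDual ℂ A,
    sliceLeft (normalExt (conv Φ μ ν)) V =
      sliceLeft (normalExt μ) V * sliceLeft (normalExt ν) V

namespace CStarEberlein

variable {H : Type v} [NormedAddCommGroup H] [InnerProductSpace ℂ H] [CompleteSpace H]

/-- The element `a · μ` of `A**`, as a function on `A*`: `⟨a · μ, ν⟩ = ⟨a, μ ⋆ ν⟩`. -/
def actRight (S : CStarEberlein A H) (a : A) (μ : StrongDual ℂ A) : StrongDual ℂ A → ℂ :=
  fun ν => conv S.Φ μ ν a

/-- A left invariant mean: a state `M` on `A` with `⟨M, a · μ⟩ = ⟨M, a⟩` for all states `μ` and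
all `a ∈ A`. -/
def IsLeftInvariantMean (S : CStarEberlein A H) (M : StrongDual ℂ A) : Prop :=
  IsState M ∧ ∀ μ : StrongDual ℂ A, IsState μ → ∀ a : A, S.actRight a μ M = M a

end CStarEberlein

end Eberlein

end EberleinAlg

end

/-!
Write `T_μ = (μ ⊗ id)(V)` for a state `μ` of `A`, and `a_ω = (id ⊗ ω)(V)` for a normal functional
`ω` on `B(H)`. By hypothesis `a_ω` lies in `A`, and `ω(T_μ) = μ(a_ω)`
(`CStarEberlein.apply_coefficientOp`). Hence `μ ↦ T_μ` is continuous from the weak-* topology to the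
weak operator topology, it is affine, and it is injective on states because the elements `a_ω` are
dense in `A`. Since `‖V‖ ≤ 1`, every `T_μ` is a contraction, and `T_{μ ⋆ ν} = T_μ T_ν`. So the `T_μ`
form a convex semigroup of contractions on a Hilbert space, compact in the weak operator topology.
As in the Alaoglu–Birkhoff ergodic theorem, such a semigroup contains an element `T_M` with
`T_μ T_M = T_M` for all `μ` (`exists_forall_mul_eq`): for a single vector `ξ` one takes a point of
minimal norm in the orbit of `ξ`, which is fixed by the parallelogram law, and compactness allows
all vectors to be treated at once. By injectivity `μ ⋆ M = M`, so `M` is a left invariant mean.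

The semigroup property needs `μ ⋆ ν` to be a state, and this is where the structure of
`A** ⊗ A**` enters. A state is a vector state in the universal representation
(`IsState.exists_vector`). Two normal functionals which agree on `A` agree on `A**` and have the
same slices on `A** ⊗ N` (`IsNormal.sliceLeft_eq_zero`); the reason is von Neumann's double commutant
theorem, applied to the amplification of an operator to countably many copies of its space
(`tsum_inner_eq_zero_of_mem_vnGenerated`). Hence the normal extensions of `μ` and `ν` may be replaced
by vector functionals of vectors `ξ` and `η`, and `μ ⋆ ν` is the composition of `Φ` with the vector
state of `ξ ⊗ η` (`conv_apply_eq_inner`).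
-/

noncomputable section

namespace EberleinAlg

universe u v w

/-! ### The double commutant theorem for normal functionals -/

section VonNeumann

variable {H : Type v} [NormedAddCommGroup H] [InnerProductSpace ℂ H] [CompleteSpace H]

variable (H) in
/-- The amplification `x ↦ x ⊕ x ⊕ ⋯` of `B(H)` to the Hilbert sum of countably many copies
of `H`. -/
def amplification : (H →L[ℂ] H) →⋆ₐ[ℂ] (lp (fun _ : ℕ => H) 2 →L[ℂ] lp (fun _ : ℕ => H) 2) :=
  directSumRep fun _ : ℕ => StarAlgHom.id ℂ (H →L[ℂ] H)

theorem amplification_apply (x : H →L[ℂ] H) (ζ : lp (fun _ : ℕ => H) 2) (n : ℕ) :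
    amplification H x ζ n = x (ζ n) := rfl

theorem amplification_single (x : H →L[ℂ] H) (j : ℕ) (h : H) :
    amplification H x (lp.single 2 j h) = lp.single 2 j (x h) := by
  ext i
  rw [amplification_apply]
  by_cases hij : i = j
  · subst hij; simp
  · simp [hij]

/-- An operator on the amplified space is an infinite matrix of operators on `H`, and it commutes
with the amplification of `x` as soon as its entries commute with `x`. -/
theorem amplification_commute_of_mem_centralizer {S : Set (H →L[ℂ] H)} {x : H →L[ℂ] H}
    (hx : x ∈ Set.centralizer (Set.centralizer S))
    (p : lp (fun _ : ℕ => H) 2 →L[ℂ] lp (fun _ : ℕ => H) 2)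
    (hp : ∀ s ∈ S, ∀ ζ, amplification H s (p ζ) = p (amplification H s ζ))
    (ζ : lp (fun _ : ℕ => H) 2) :
    amplification H x (p ζ) = p (amplification H x ζ) := by
  have entry : ∀ (i j : ℕ) (h : H),
      x (p (lp.single 2 j h) i) = p (lp.single 2 j (x h)) i := by
    intro i j h
    let q : H →L[ℂ] H := lp.evalCLM ℂ (fun _ : ℕ => H) 2 i ∘L p ∘L
      lp.singleContinuousLinearMap ℂ (fun _ : ℕ => H) 2 j
    have hq : q ∈ Set.centralizer S := by
      intro s hs
      ext h
      change s (p (lp.single 2 j h) i) = p (lp.single 2 j (s h)) i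
      rw [← amplification_apply, hp s hs, amplification_single]
    exact (DFunLike.congr_fun (hx q hq) h).symm
  have single : ∀ (j : ℕ) (h : H), amplification H x (p (lp.single 2 j h)) =
      p (amplification H x (lp.single 2 j h)) := by
    intro j h
    ext i
    rw [amplification_apply, entry, amplification_single]
  have hζ := lp.hasSum_single (E := fun _ : ℕ => H) (p := 2) (by norm_num) ζ
  have h1 := ((amplification H x ∘L p).hasSum hζ)
  have h2 := ((p ∘L amplification H x).hasSum hζ)
  rw [show (fun j => (amplification H x ∘L p) (lp.single 2 j (ζ j))) =
    fun j => (p ∘L amplification H x) (lp.single 2 j (ζ j)) from funext fun j => single j _] at h1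
  exact h1.unique h2

/-- Von Neumann's double commutant theorem, stated for normal functionals: a functional
`x ↦ ∑ₙ (x ξₙ | ηₙ)` that vanishes on a `*`-closed multiplicative set of operators vanishes on the
von Neumann algebra generated by it. -/
theorem tsum_inner_eq_zero_of_mem_vnGenerated {S : Set (H →L[ℂ] H)} (h_one : 1 ∈ S)
    (h_mul : ∀ s ∈ S, ∀ t ∈ S, s * t ∈ S) (h_star : ∀ s ∈ S, star s ∈ S) {ξ η : ℕ → H}
    (hξ : Summable fun n => ‖ξ n‖ ^ 2) (hη : Summable fun n => ‖η n‖ ^ 2)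
    (h : ∀ s ∈ S, ∑' n, ⟪η n, s (ξ n)⟫_ℂ = 0) {x : H →L[ℂ] H} (hx : x ∈ vnGenerated S) :
    ∑' n, ⟪η n, x (ξ n)⟫_ℂ = 0 := by
  have hx' : x ∈ Set.centralizer (Set.centralizer S) := by
    have hS : S ∪ star S = S :=
      Set.union_eq_left.2 fun s hs => by simpa using h_star _ hs
    have : x ∈ Set.centralizer (Set.centralizer (S ∪ star S)) := by
      rw [← StarSubalgebra.coe_centralizer_centralizer ℂ S]; exact hx
    rwa [hS] at this
  -- The sequences `ξ` and `η` become single vectors of the amplified space. The cyclic subspace `W`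
  -- of `ξ'` reduces the amplification of `S`, so its projection commutes with the amplified `x`.
  let ξ' : lp (fun _ : ℕ => H) 2 := ⟨ξ, memℓp_gen (by simpa using hξ)⟩
  let η' : lp (fun _ : ℕ => H) 2 := ⟨η, memℓp_gen (by simpa using hη)⟩
  have inner_eq : ∀ y : H →L[ℂ] H,
      ⟪η', amplification H y ξ'⟫_ℂ = ∑' n, ⟪η n, y (ξ n)⟫_ℂ := fun y => lp.inner_eq_tsum _ _
  let W : Submodule ℂ (lp (fun _ : ℕ => H) 2) :=
    (Submodule.span ℂ ((fun s => amplification H s ξ') '' S)).topologicalClosure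
  have : CompleteSpace W :=
    (Submodule.isClosed_topologicalClosure _).completeSpace_coe
  have W_mem : ∀ s ∈ S, amplification H s ξ' ∈ W := fun s hs =>
    Submodule.le_topologicalClosure _ (Submodule.subset_span ⟨s, hs, rfl⟩)
  have hξ' : ξ' ∈ W := by simpa using W_mem 1 h_one
  have W_inv : ∀ s ∈ S, ∀ ζ ∈ W, amplification H s ζ ∈ W := by
    intro s hs
    have hle : W ≤ W.comap (amplification H s).toLinearMap := by
      refine Submodule.topologicalClosure_minimal _ ?_ ?_
      · rw [Submodule.span_le]
        rintro _ ⟨t, ht, rfl⟩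
        have := W_mem _ (h_mul s hs t ht)
        rw [map_mul] at this
        exact this
      · exact (Submodule.isClosed_topologicalClosure _).preimage (amplification H s).continuous
    exact fun ζ hζ => hle hζ
  have W_orth : ∀ s ∈ S, ∀ ζ ∈ Wᗮ, amplification H s ζ ∈ Wᗮ := by
    intro s hs ζ hζ
    rw [Submodule.mem_orthogonal] at hζ ⊢
    intro u hu
    rw [← ContinuousLinearMap.adjoint_inner_left, ← ContinuousLinearMap.star_eq_adjoint,
      ← map_star]
    exact hζ _ (W_inv _ (h_star s hs) u hu)
  have comm : ∀ s ∈ S, ∀ ζ, amplification H s (W.starProjection ζ) =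
      W.starProjection (amplification H s ζ) := by
    intro s hs ζ
    refine (Submodule.eq_starProjection_of_mem_of_inner_eq_zero
      (W_inv s hs _ (W.starProjection_apply_mem ζ)) ?_).symm
    have hz := W_orth s hs _ (W.sub_starProjection_mem_orthogonal ζ)
    rw [map_sub] at hz
    intro w hw
    exact (Submodule.mem_orthogonal' _ _).1 hz w hw
  have hxW : amplification H x ξ' ∈ W := by
    have := amplification_commute_of_mem_centralizer hx' W.starProjection comm ξ'
    rw [Submodule.starProjection_eq_self_iff.2 hξ'] at this
    rw [this]
    exact W.starProjection_apply_mem _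
  have hη' : W ≤ (innerSL ℂ η').toLinearMap.ker := by
    refine Submodule.topologicalClosure_minimal _ ?_ (innerSL ℂ η').isClosed_ker
    rw [Submodule.span_le]
    rintro _ ⟨s, hs, rfl⟩
    exact (inner_eq s).trans (h s hs)
  rw [← inner_eq]
  exact hη' hxW

end VonNeumann

/-! ### Operators on the Hilbert space tensor product -/

section HilbertTensor

variable {H : Type v} [NormedAddCommGroup H] [InnerProductSpace ℂ H]
  {K : Type w} [NormedAddCommGroup K] [InnerProductSpace ℂ K]

theorem ketRight_eq (α : K) (ξ : H) : ketRight H K α ξ = ketLeft H K ξ α := rfl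

theorem ketLeft_apply (ξ : H) (α : K) :
    ketLeft H K ξ α = ((ξ ⊗ₜ[ℂ] α : H ⊗[ℂ] K) : HTensor H K) := rfl

theorem norm_ketLeft_apply (ξ : H) (α : K) : ‖ketLeft H K ξ α‖ = ‖ξ‖ * ‖α‖ := by
  rw [ketLeft_apply, UniformSpace.Completion.norm_coe, TensorProduct.norm_tmul]

theorem inner_ketLeft (ξ η : H) (α β : K) :
    ⟪ketLeft H K ξ α, ketLeft H K η β⟫_ℂ = ⟪ξ, η⟫_ℂ * ⟪α, β⟫_ℂ := by
  rw [ketLeft_apply, ketLeft_apply, UniformSpace.Completion.inner_coe, TensorProduct.inner_tmul]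

theorem opTensor_ketLeft (x : H →L[ℂ] H) (y : K →L[ℂ] K) (ξ : H) (α : K) :
    opTensor x y (ketLeft H K ξ α) = ketLeft H K (x ξ) (y α) := by
  rw [ketLeft_apply, ketLeft_apply, opTensor, ContinuousLinearMap.completion_apply_coe]
  rfl

theorem ext_hTensor {F : Type*} [NormedAddCommGroup F] [NormedSpace ℂ F]
    {S T : HTensor H K →L[ℂ] F}
    (h : ∀ ξ α, S (ketLeft H K ξ α) = T (ketLeft H K ξ α)) : S = T := by
  ext z
  refine UniformSpace.Completion.induction_on z (isClosed_eq S.continuous T.continuous) ?_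
  intro t
  induction t using TensorProduct.induction_on with
  | zero => rw [UniformSpace.Completion.coe_zero, map_zero, map_zero]
  | tmul ξ α => exact h ξ α
  | add a b ha hb => rw [UniformSpace.Completion.coe_add, map_add, map_add, ha, hb]

theorem opTensor_one : opTensor (1 : H →L[ℂ] H) (1 : K →L[ℂ] K) = 1 :=
  ext_hTensor fun ξ α => by simp [opTensor_ketLeft]

theorem opTensor_mul (x x' : H →L[ℂ] H) (y y' : K →L[ℂ] K) :
    opTensor x y * opTensor x' y' = opTensor (x * x') (y * y') :=
  ext_hTensor fun ξ α => by simp [opTensor_ketLeft]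

variable [CompleteSpace H] [CompleteSpace K]

theorem star_opTensor (x : H →L[ℂ] H) (y : K →L[ℂ] K) :
    star (opTensor x y) = opTensor (star x) (star y) := by
  refine ext_hTensor fun ξ α => ?_
  refine (innerSL_inj (𝕜 := ℂ)).1 (ext_hTensor fun η β => ?_)
  rw [innerSL_apply_apply, innerSL_apply_apply, ContinuousLinearMap.star_eq_adjoint,
    ContinuousLinearMap.adjoint_inner_left, opTensor_ketLeft, opTensor_ketLeft, inner_ketLeft,
    inner_ketLeft]
  simp [ContinuousLinearMap.star_eq_adjoint, ContinuousLinearMap.adjoint_inner_left]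

end HilbertTensor

/-! ### Normal functionals and slice maps -/

section Normal

variable {H : Type v} [NormedAddCommGroup H] [InnerProductSpace ℂ H]

/-- The functional `x ↦ (x α | β)` on `B(H)`. -/
def vecFunctional (α β : H) : StrongDual ℂ (H →L[ℂ] H) :=
  innerSL ℂ β ∘L ContinuousLinearMap.apply ℂ H α

theorem vecFunctional_apply (α β : H) (x : H →L[ℂ] H) :
    vecFunctional α β x = ⟪β, x α⟫_ℂ := rfl

theorem isNormal_vecFunctional (α β : H) : IsNormal (vecFunctional α β) := by
  refine ⟨Pi.single 0 α, Pi.single 0 β, summable_of_ne_finset_zero (s := {0}) ?_,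
    summable_of_ne_finset_zero (s := {0}) ?_, fun x => ?_⟩
  · intro n hn
    simp [show n ≠ 0 by simpa using hn]
  · intro n hn
    simp [show n ≠ 0 by simpa using hn]
  · have := hasSum_single (f := fun n : ℕ =>
      ⟪(Pi.single 0 β : ℕ → H) n, x ((Pi.single 0 α : ℕ → H) n)⟫_ℂ) 0 fun n hn => by simp [hn]
    simpa [vecFunctional_apply] using this

theorem IsNormal.sub_vecFunctional {f : StrongDual ℂ (H →L[ℂ] H)} (hf : IsNormal f) (α β : H) :
    IsNormal (f - vecFunctional α β) := by
  obtain ⟨ξ, η, hξ, hη, h⟩ := hf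
  refine ⟨fun n => Nat.casesOn n α ξ, fun n => Nat.casesOn n (-β) η, ?_, ?_, fun x => ?_⟩
  · exact (summable_nat_add_iff 1).1 hξ
  · exact (summable_nat_add_iff 1).1 hη
  · rw [← hasSum_nat_add_iff' 1]
    simpa [vecFunctional_apply, sub_eq_add_neg] using h x

variable [CompleteSpace H]

/-- A normal functional that vanishes on a `*`-closed multiplicative set of operators vanishes on
the von Neumann algebra generated by it. -/
theorem IsNormal.eq_zero_of_mem_vnGenerated {f : StrongDual ℂ (H →L[ℂ] H)} (hf : IsNormal f)
    {S : Set (H →L[ℂ] H)} (h_one : 1 ∈ S) (h_mul : ∀ s ∈ S, ∀ t ∈ S, s * t ∈ S)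
    (h_star : ∀ s ∈ S, star s ∈ S) (h : ∀ s ∈ S, f s = 0) {x : H →L[ℂ] H}
    (hx : x ∈ vnGenerated S) : f x = 0 := by
  obtain ⟨ξ, η, hξ, hη, hf⟩ := hf
  rw [← (hf x).tsum_eq]
  exact tsum_inner_eq_zero_of_mem_vnGenerated h_one h_mul h_star hξ hη
    (fun s hs => (hf s).tsum_eq.trans (h s hs)) hx

end Normal

section Slice

variable {H : Type v} [NormedAddCommGroup H] [InnerProductSpace ℂ H] [CompleteSpace H]
  {K : Type w} [NormedAddCommGroup K] [InnerProductSpace ℂ K] [CompleteSpace K]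

theorem one_mem_opTensor (M : VonNeumannAlgebra H) (N : VonNeumannAlgebra K) :
    (1 : HTensor H K →L[ℂ] HTensor H K) ∈ {z | ∃ x ∈ M, ∃ y ∈ N, z = opTensor x y} :=
  ⟨1, one_mem M, 1, one_mem N, opTensor_one.symm⟩

theorem star_mem_opTensor (M : VonNeumannAlgebra H) (N : VonNeumannAlgebra K) :
    ∀ s ∈ {z : HTensor H K →L[ℂ] HTensor H K | ∃ x ∈ M, ∃ y ∈ N, z = opTensor x y},
      star s ∈ {z : HTensor H K →L[ℂ] HTensor H K | ∃ x ∈ M, ∃ y ∈ N, z = opTensor x y} := by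
  rintro _ ⟨x, hx, y, hy, rfl⟩
  exact ⟨star x, star_mem hx, star y, star_mem hy, star_opTensor x y⟩

theorem inner_sliceLeft (f : StrongDual ℂ (H →L[ℂ] H)) (X : HTensor H K →L[ℂ] HTensor H K)
    (α β : K) :
    ⟪β, sliceLeft f X α⟫_ℂ =
      f (ContinuousLinearMap.adjoint (ketRight H K β) ∘L X ∘L ketRight H K α) :=
  inner_sliceOp _ _ _ _ _

theorem inner_sliceRight (g : StrongDual ℂ (K →L[ℂ] K)) (X : HTensor H K →L[ℂ] HTensor H K)
    (ξ η : H) :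
    ⟪η, sliceRight g X ξ⟫_ℂ =
      g (ContinuousLinearMap.adjoint (ketLeft H K η) ∘L X ∘L ketLeft H K ξ) :=
  inner_sliceOp _ _ _ _ _

theorem sliceLeft_sub (f g : StrongDual ℂ (H →L[ℂ] H)) (X : HTensor H K →L[ℂ] HTensor H K) :
    sliceLeft (f - g) X = sliceLeft f X - sliceLeft g X := by
  ext α
  refine ext_inner_left ℂ fun β => ?_
  rw [sub_apply, inner_sub_right]
  simp only [inner_sliceLeft, sub_apply]

theorem inner_sliceLeft_vecFunctional (ξ η : H) (X : HTensor H K →L[ℂ] HTensor H K) (α β : K) :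
    ⟪β, sliceLeft (vecFunctional ξ η) X α⟫_ℂ = ⟪ketLeft H K η β, X (ketLeft H K ξ α)⟫_ℂ := by
  rw [inner_sliceLeft, vecFunctional_apply, ContinuousLinearMap.comp_apply,
    ContinuousLinearMap.adjoint_inner_right]
  rfl

theorem norm_sliceLeft_vecFunctional_le (ξ : H) (X : HTensor H K →L[ℂ] HTensor H K) :
    ‖sliceLeft (vecFunctional ξ ξ) X‖ ≤ ‖ξ‖ ^ 2 * ‖X‖ := by
  refine ContinuousLinearMap.opNorm_le_of_re_inner_le (𝕜 := ℂ) (by positivity) fun α β hα hβ => ?_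
  refine (RCLike.re_le_norm _).trans ?_
  rw [norm_inner_symm, inner_sliceLeft_vecFunctional]
  refine (norm_inner_le_norm _ _).trans ?_
  refine (mul_le_mul_of_nonneg_left (X.le_opNorm _) (norm_nonneg _)).trans ?_
  rw [norm_ketLeft_apply, norm_ketLeft_apply, hα, hβ]
  exact le_of_eq (by ring)

/-- Slices of `M ⊗ N` by a normal functional depend only on the restriction of this functional to
`M`: each matrix coefficient of the slice is a normal functional on `B(H ⊗ K)` that vanishes on the
generators `x ⊗ y`. -/
theorem IsNormal.sliceLeft_eq_zero {f : StrongDual ℂ (H →L[ℂ] H)} (hf : IsNormal f)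
    {M : VonNeumannAlgebra H} {N : VonNeumannAlgebra K} (h : ∀ x ∈ M, f x = 0)
    {X : HTensor H K →L[ℂ] HTensor H K} (hX : X ∈ vnTensor M N) : sliceLeft f X = 0 := by
  obtain ⟨ξ, η, hξ, hη, hf⟩ := hf
  ext α
  refine ext_inner_left ℂ fun β => ?_
  have coeff : ∀ Y : HTensor H K →L[ℂ] HTensor H K, ⟪β, sliceLeft f Y α⟫_ℂ =
      ∑' n, ⟪ketLeft H K (η n) β, Y (ketLeft H K (ξ n) α)⟫_ℂ := by
    intro Y
    rw [inner_sliceLeft, ← (hf _).tsum_eq]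
    refine tsum_congr fun n => ?_
    rw [ContinuousLinearMap.comp_apply, ContinuousLinearMap.adjoint_inner_right]
    rfl
  rw [coeff, zero_apply, inner_zero_right]
  refine tsum_inner_eq_zero_of_mem_vnGenerated (one_mem_opTensor M N) ?_
    (star_mem_opTensor M N) ?_ ?_ ?_ hX
  · rintro _ ⟨x, hx, y, hy, rfl⟩ _ ⟨x', hx', y', hy', rfl⟩
    exact ⟨x * x', mul_mem hx hx', y * y', mul_mem hy hy', opTensor_mul x x' y y'⟩
  · simpa only [norm_ketLeft_apply, mul_pow] using hξ.mul_right _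
  · simpa only [norm_ketLeft_apply, mul_pow] using hη.mul_right _
  · rintro _ ⟨x, hx, y, hy, rfl⟩
    simp only [opTensor_ketLeft, inner_ketLeft]
    rw [tsum_mul_right, (hf x).tsum_eq, h x hx, zero_mul]

/-- The slice map `f ⊗ id` sends `M ⊗ N` to `N`: if `y` commutes with `N`, then `1 ⊗ y` commutes
with `M ⊗ N`, and hence `y` commutes with the slices. -/
theorem sliceLeft_mem (f : StrongDual ℂ (H →L[ℂ] H)) {M : VonNeumannAlgebra H}
    {N : VonNeumannAlgebra K} {X : HTensor H K →L[ℂ] HTensor H K} (hX : X ∈ vnTensor M N) :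
    sliceLeft f X ∈ N := by
  have key : sliceLeft f X ∈ Set.centralizer (Set.centralizer (N : Set (K →L[ℂ] K))) := by
    intro y hy
    have hy_star : star y ∈ Set.centralizer (N : Set (K →L[ℂ] K)) := by
      intro z hz
      have := congrArg star (hy (star z) (star_mem hz))
      simpa using this.symm
    have h_comm : ∀ z ∈ Set.centralizer (N : Set (K →L[ℂ] K)),
        ∀ s ∈ {s : HTensor H K →L[ℂ] HTensor H K | ∃ x ∈ M, ∃ y ∈ N, s = opTensor x y},
          s * opTensor 1 z = opTensor 1 z * s := by
      rintro z hz _ ⟨a, -, b, hb, rfl⟩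
      rw [opTensor_mul, opTensor_mul, hz b hb, mul_one, one_mul]
    have hXy : opTensor 1 y * X = X * opTensor 1 y := by
      have hX' : X ∈ StarSubalgebra.centralizer ℂ (StarSubalgebra.centralizer ℂ
        {s : HTensor H K →L[ℂ] HTensor H K | ∃ x ∈ M, ∃ y ∈ N, s = opTensor x y} :
          Set (HTensor H K →L[ℂ] HTensor H K)) := hX
      rw [StarSubalgebra.mem_centralizer_iff] at hX'
      refine (hX' _ ?_).1
      rw [SetLike.mem_coe, StarSubalgebra.mem_centralizer_iff]
      exact fun s hs => ⟨h_comm y hy s hs, h_comm y hy _ (star_mem_opTensor M N s hs)⟩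
    have hXy_apply : ∀ ζ, opTensor 1 y (X ζ) = X (opTensor 1 y ζ) := DFunLike.congr_fun hXy
    ext α
    refine ext_inner_left ℂ fun β => ?_
    change ⟪β, y (sliceLeft f X α)⟫_ℂ = ⟪β, sliceLeft f X (y α)⟫_ℂ
    rw [← ContinuousLinearMap.adjoint_inner_left, inner_sliceLeft, inner_sliceLeft]
    congr 1
    ext ξ
    refine ext_inner_left ℂ fun η => ?_
    simp only [ContinuousLinearMap.comp_apply, ContinuousLinearMap.adjoint_inner_right]
    have h1 : ketLeft H K η (ContinuousLinearMap.adjoint y β) =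
        ContinuousLinearMap.adjoint (opTensor (1 : H →L[ℂ] H) y) (ketLeft H K η β) := by
      rw [← ContinuousLinearMap.star_eq_adjoint (opTensor (1 : H →L[ℂ] H) y), star_opTensor,
        opTensor_ketLeft, star_one]
      rfl
    have h2 : ketLeft H K ξ (y α) = opTensor (1 : H →L[ℂ] H) y (ketLeft H K ξ α) := by
      rw [opTensor_ketLeft]
      rfl
    rw [ketRight_eq, ketRight_eq, ketRight_eq, ketRight_eq, h1, h2,
      ContinuousLinearMap.adjoint_inner_left, hXy_apply]
  have hN : Set.centralizer (Set.centralizer (N : Set (K →L[ℂ] K))) = N :=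
    N.centralizer_centralizer
  rw [hN] at key
  exact key

end Slice

/-! ### Compact convex semigroups of contractions -/

section Semigroup

variable {H : Type v} [NormedAddCommGroup H] [InnerProductSpace ℂ H]
  {X : Type*} [TopologicalSpace X] [CompactSpace X] [Nonempty X] {T : X → H →L[ℂ] H}

theorem lowerSemicontinuous_norm_of_continuous_inner {X : Type*} [TopologicalSpace X] {v : X → H}
    (h : ∀ β, Continuous fun x => ⟪β, v x⟫_ℂ) : LowerSemicontinuous fun x => ‖v x‖ := by
  rw [lowerSemicontinuous_iff_isClosed_preimage]
  intro r
  have : (fun x => ‖v x‖) ⁻¹' Set.Iic r =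
      {x | 0 ≤ r} ∩ ⋂ β : H, {x | ‖⟪β, v x⟫_ℂ‖ ≤ ‖β‖ * r} := by
    ext x
    simp only [Set.mem_preimage, Set.mem_Iic, Set.mem_inter_iff, Set.mem_ofPred_eq, Set.mem_iInter]
    refine ⟨fun hx => ⟨(norm_nonneg _).trans hx, fun β => (norm_inner_le_norm _ _).trans ?_⟩,
      fun ⟨hr, hx⟩ => ?_⟩
    · gcongr
    · rcases (norm_nonneg (v x)).eq_or_lt with h0 | h0
      · rwa [← h0]
      · have := hx (v x)
        rw [inner_self_eq_norm_sq_to_K, norm_pow, RCLike.norm_ofReal, abs_norm, sq] at this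
        exact le_of_mul_le_mul_left this h0
  rw [this]
  exact isClosed_const.inter
    (isClosed_iInter fun β => isClosed_le (h β).norm continuous_const)

/-- For a single vector `ξ`, a fixed vector of the form `T x ξ` is found as an element of minimal
norm of the orbit of `ξ`, as in the Alaoglu–Birkhoff ergodic theorem. -/
theorem exists_forall_apply_apply_eq
    (h_cont : ∀ α β, Continuous fun x => ⟪β, T x α⟫_ℂ) (h_norm : ∀ x, ‖T x‖ ≤ 1)
    (h_mul : ∀ x y, ∃ z, T z = T x * T y)
    (h_mid : ∀ x y, ∃ z, T z = (2⁻¹ : ℂ) • (T x + T y)) (ξ : H) :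
    ∃ m, ∀ x, T x (T m ξ) = T m ξ := by
  obtain ⟨m, -, hm⟩ := ((lowerSemicontinuous_norm_of_continuous_inner
    (h_cont ξ)).lowerSemicontinuousOn Set.univ).exists_isMinOn Set.univ_nonempty isCompact_univ
  refine ⟨m, fun x => ?_⟩
  have h1 : ‖T x (T m ξ)‖ ≤ ‖T m ξ‖ :=
    (T x).le_of_opNorm_le (h_norm x) _ |>.trans_eq (one_mul _)
  obtain ⟨y, hy⟩ := h_mul x m
  obtain ⟨z, hz⟩ := h_mid y m
  have h2 : ‖T m ξ‖ ≤ ‖T z ξ‖ := hm (Set.mem_univ z)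
  have h3 : T z ξ = (2⁻¹ : ℂ) • (T x (T m ξ) + T m ξ) := by rw [hz, hy]; rfl
  rw [h3, norm_smul, norm_inv, Complex.norm_ofNat] at h2
  -- The midpoint of `T m ξ` and `T x (T m ξ)` has at least the norm of the two, so the
  -- parallelogram law forces them to coincide.
  have h4 := parallelogram_law_with_norm ℂ (T x (T m ξ)) (T m ξ)
  have h5 : ‖T x (T m ξ) - T m ξ‖ = 0 := by
    nlinarith [norm_nonneg (T x (T m ξ)), norm_nonneg (T m ξ),
      norm_nonneg (T x (T m ξ) - T m ξ), norm_nonneg (T x (T m ξ) + T m ξ)]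
  exact sub_eq_zero.1 (norm_eq_zero.1 h5)

/-- A convex semigroup of contractions on a Hilbert space that is compact for the weak operator
topology contains an element `T m` absorbed by multiplication from the left. Compactness reduces this to
finitely many vectors, which are treated one after the other: a vector that has become fixed stays
so under further multiplication. -/
theorem exists_forall_mul_eq
    (h_cont : ∀ α β, Continuous fun x => ⟪β, T x α⟫_ℂ) (h_norm : ∀ x, ‖T x‖ ≤ 1)
    (h_mul : ∀ x y, ∃ z, T z = T x * T y)
    (h_mid : ∀ x y, ∃ z, T z = (2⁻¹ : ℂ) • (T x + T y)) [CompleteSpace H] :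
    ∃ m, ∀ x, T x * T m = T m := by
  have h_closed : ∀ ξ, IsClosed {m | ∀ x, T x (T m ξ) = T m ξ} := by
    intro ξ
    have : {m | ∀ x, T x (T m ξ) = T m ξ} =
        ⋂ (x : X) (β : H), {m | ⟪ContinuousLinearMap.adjoint (T x) β, T m ξ⟫_ℂ =
          ⟪β, T m ξ⟫_ℂ} := by
      ext m
      simp only [Set.mem_ofPred_eq, Set.mem_iInter, ContinuousLinearMap.adjoint_inner_left]
      exact forall_congr' fun x => ⟨fun h β => by rw [h], fun h => ext_inner_left ℂ h⟩
    rw [this]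
    exact isClosed_iInter fun x => isClosed_iInter fun β =>
      isClosed_eq (h_cont _ _) (h_cont _ _)
  have h_fin : ∀ s : Finset H, ∃ m, ∀ ξ ∈ s, ∀ x, T x (T m ξ) = T m ξ := by
    intro s
    induction s using Finset.cons_induction with
    | empty => exact ⟨Classical.arbitrary X, by simp⟩
    | cons ζ s hζ ih =>
      obtain ⟨m, hm⟩ := ih
      obtain ⟨n, hn⟩ := exists_forall_apply_apply_eq h_cont h_norm h_mul h_mid (T m ζ)
      obtain ⟨k, hk⟩ := h_mul n m
      refine ⟨k, fun ξ hξ x => ?_⟩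
      rw [hk]
      change T x (T n (T m ξ)) = T n (T m ξ)
      rcases Finset.mem_cons.1 hξ with rfl | hξ
      · exact hn x
      · rw [hm ξ hξ n, hm ξ hξ x]
  obtain ⟨m, -, hm⟩ := isCompact_univ.inter_iInter_nonempty _ h_closed fun s => by
    obtain ⟨m, hm⟩ := h_fin s
    exact ⟨m, Set.mem_univ m, Set.mem_iInter₂.2 hm⟩
  exact ⟨m, fun x => ContinuousLinearMap.ext fun ξ => Set.mem_iInter.1 hm ξ x⟩

end Semigroup

/-! ### States as vector states of the universal representation -/

section States

variable {A : Type u} [CStarAlgebra A] [PartialOrder A] [StarOrderedRing A]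

omit [PartialOrder A] [StarOrderedRing A] in
theorem norm_add_I_smul_sq_le {a : A} (ha : IsSelfAdjoint a) [Nontrivial A] (t : ℝ) :
    ‖a + ((t : ℂ) * Complex.I) • (1 : A)‖ ^ 2 ≤ ‖a‖ ^ 2 + t ^ 2 := by
  have h : star (a + ((t : ℂ) * Complex.I) • (1 : A)) * (a + ((t : ℂ) * Complex.I) • (1 : A)) =
      a * a + ((t : ℂ) ^ 2) • (1 : A) := by
    have h_star : star ((t : ℂ) * Complex.I) = -(t * Complex.I) := by simp
    have h_sq : ((t : ℂ) * Complex.I) * (t * Complex.I) = -(t : ℂ) ^ 2 := by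
      linear_combination ((t : ℂ) ^ 2) * Complex.I_sq
    generalize (t : ℂ) * Complex.I = c at h_star h_sq ⊢
    rw [show ((t : ℂ) ^ 2) = -(c * c) by rw [h_sq, neg_neg]]
    simp only [star_add, star_smul, star_one, ha.star_eq, h_star, add_mul, mul_add,
      smul_mul_assoc, mul_smul_comm, one_mul, mul_one]
    module
  rw [sq, ← CStarRing.norm_star_mul_self, h]
  refine (norm_add_le _ _).trans (add_le_add ?_ ?_)
  · exact (norm_mul_le _ _).trans_eq (sq _).symm
  · simp [norm_smul]

/-- A functional of norm at most one with value `1` at the unit is a state. -/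
theorem isState_of_norm_le_one [Nontrivial A] {μ : StrongDual ℂ A} (h_norm : ‖μ‖ ≤ 1)
    (h_one : μ 1 = 1) : IsState μ := by
  refine ⟨h_one, fun a ha => ?_⟩
  have le_norm : ∀ b : A, ‖μ b‖ ≤ ‖b‖ := fun b =>
    (μ.le_of_opNorm_le h_norm b).trans_eq (one_mul _)
  -- As `0 ≤ a ≤ ‖a‖`, the value `μ a` lies in the disc of radius `‖a‖` about `‖a‖`.
  have h_re : ‖(‖a‖ : ℂ) - μ a‖ ≤ ‖a‖ := by
    have h1 : ‖algebraMap ℝ A ‖a‖ - a‖ ≤ ‖a‖ := by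
      rw [CStarAlgebra.norm_le_iff_le_algebraMap _ (norm_nonneg a)
        (sub_nonneg.2 (IsSelfAdjoint.of_nonneg ha).le_algebraMap_norm_self)]
      exact sub_le_self _ ha
    have h2 : μ (algebraMap ℝ A ‖a‖ - a) = (‖a‖ : ℂ) - μ a := by
      rw [map_sub, Algebra.algebraMap_eq_smul_one, ← Complex.coe_smul, map_smul, h_one]
      simp
    rw [← h2]
    exact (le_norm _).trans h1
  -- The bound on `‖a + it‖` is quadratic in `t`, while an imaginary part of `μ a` would make
  -- `‖μ (a + it)‖ ^ 2 - t ^ 2` grow linearly in `t`.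
  have h_im : (μ a).im = 0 := by
    have key : ∀ t : ℝ, 2 * (μ a).im * t ≤ ‖a‖ ^ 2 := by
      intro t
      have h1 := (pow_le_pow_left₀ (norm_nonneg _) (le_norm _) 2).trans
        (norm_add_I_smul_sq_le (IsSelfAdjoint.of_nonneg ha) t)
      rw [map_add, map_smul, h_one, Complex.sq_norm, Complex.normSq_apply] at h1
      simp at h1
      nlinarith [sq_nonneg (μ a).re, sq_nonneg (μ a).im]
    by_contra hne
    have := key ((‖a‖ ^ 2 + 1) / (2 * (μ a).im))
    rw [mul_div_cancel₀ _ (by simpa using hne)] at this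
    linarith
  rw [Complex.le_def]
  refine ⟨?_, by simpa using h_im.symm⟩
  have := (Complex.abs_re_le_norm _).trans h_re
  rw [abs_le] at this
  simp at this
  simpa using this.2

variable (A) in
theorem exists_isState [Nontrivial A] : ∃ μ : StrongDual ℂ A, IsState μ := by
  obtain ⟨μ, h_norm, h_one⟩ := exists_dual_vector ℂ (1 : A) (by simp)
  exact ⟨μ, isState_of_norm_le_one h_norm.le (by simpa using h_one)⟩

/-- The GNS construction: every state is a vector state in the universal representation. -/
theorem IsState.exists_vector {μ : StrongDual ℂ A} (hμ : IsState μ) :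
    ∃ ξ : UnivSpace A, ‖ξ‖ = 1 ∧ ∀ a, ⟪ξ, univRep A a ξ⟫_ℂ = μ a := by
  classical
  let φ : A →ₚ[ℂ] ℂ := PositiveLinearMap.mk₀ (μ : A →ₗ[ℂ] ℂ) hμ.2
  let i : {φ : A →ₚ[ℂ] ℂ // φ 1 = 1} := ⟨φ, hμ.1⟩
  let ζ : φ.GNS := ((φ.toPreGNS 1 : φ.PreGNS) : φ.GNS)
  let ξ : lp (fun φ : {φ : A →ₚ[ℂ] ℂ // φ 1 = 1} => φ.1.GNS) 2 := lp.single 2 i ζ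
  have h : ∀ a, ⟪ξ, directSumRep (E := fun φ : {φ : A →ₚ[ℂ] ℂ // φ 1 = 1} => φ.1.GNS)
      (fun φ => φ.1.gnsStarAlgHom) a ξ⟫_ℂ = μ a := by
    intro a
    rw [lp.inner_single_left]
    change ⟪ζ, φ.gnsStarAlgHom a (ξ i)⟫_ℂ = μ a
    rw [show ξ i = ζ from
      lp.single_apply_self (E := fun φ : {φ : A →ₚ[ℂ] ℂ // φ 1 = 1} => φ.1.GNS) 2 i ζ]
    change ⟪ζ, φ.gnsNonUnitalStarAlgHom a ζ⟫_ℂ = μ a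
    rw [PositiveLinearMap.gnsNonUnitalStarAlgHom_apply_coe, UniformSpace.Completion.inner_coe,
      PositiveLinearMap.preGNS_inner_def]
    simp
    rfl
  refine ⟨ξ, ?_, h⟩
  have h1 := h 1
  rw [map_one, hμ.1] at h1
  change ⟪ξ, ξ⟫_ℂ = 1 at h1
  have h2 : (‖ξ‖ : ℂ) ^ 2 = 1 := (inner_self_eq_norm_sq_to_K ξ).symm.trans h1
  have h3 : ‖ξ‖ ^ 2 = 1 := by exact_mod_cast h2
  exact (pow_eq_one_iff_of_nonneg (norm_nonneg ξ) two_ne_zero).1 h3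

end States

/-! ### Normal extensions and convolutions of states -/

section NormalExtension

variable {A : Type u} [CStarAlgebra A] [PartialOrder A] [StarOrderedRing A]
  {K : Type w} [NormedAddCommGroup K] [InnerProductSpace ℂ K] [CompleteSpace K]
  {μ : StrongDual ℂ A} {ξ : UnivSpace A}

/-- A vector state in the universal representation representing `μ` is a normal extension of `μ`,
so one exists and the chosen one differs from it by a normal functional vanishing on `A**`. -/
theorem isNormal_normalExt_sub_and_eq_zero (hξ : ∀ a, ⟪ξ, univRep A a ξ⟫_ℂ = μ a) :
    IsNormal (normalExt μ - vecFunctional ξ ξ) ∧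
      ∀ x ∈ bidualVN A, (normalExt μ - vecFunctional ξ ξ) x = 0 := by
  have hex : ∃ f : StrongDual ℂ (UnivSpace A →L[ℂ] UnivSpace A),
      IsNormal f ∧ ∀ a : A, f (univRep A a) = μ a :=
    ⟨vecFunctional ξ ξ, isNormal_vecFunctional ξ ξ, hξ⟩
  have hspec : IsNormal (normalExt μ) ∧ ∀ a : A, normalExt μ (univRep A a) = μ a := by
    rw [normalExt, dif_pos hex]
    exact hex.choose_spec
  have hN := hspec.1.sub_vecFunctional ξ ξ
  refine ⟨hN, fun x hx => hN.eq_zero_of_mem_vnGenerated (S := Set.range (univRep A))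
    ⟨1, map_one _⟩ ?_ ?_ ?_ hx⟩
  · rintro _ ⟨a, rfl⟩ _ ⟨b, rfl⟩
    exact ⟨a * b, map_mul _ _ _⟩
  · rintro _ ⟨a, rfl⟩
    exact ⟨star a, map_star _ _⟩
  · rintro _ ⟨a, rfl⟩
    rw [sub_apply, hspec.2, vecFunctional_apply, hξ, sub_self]

theorem normalExt_apply_of_mem (hξ : ∀ a, ⟪ξ, univRep A a ξ⟫_ℂ = μ a)
    {x : UnivSpace A →L[ℂ] UnivSpace A} (hx : x ∈ bidualVN A) :
    normalExt μ x = ⟪ξ, x ξ⟫_ℂ :=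
  sub_eq_zero.1 ((isNormal_normalExt_sub_and_eq_zero hξ).2 x hx)

theorem sliceLeft_normalExt_of_mem (hξ : ∀ a, ⟪ξ, univRep A a ξ⟫_ℂ = μ a)
    {N : VonNeumannAlgebra K} {X : HTensor (UnivSpace A) K →L[ℂ] HTensor (UnivSpace A) K}
    (hX : X ∈ vnTensor (bidualVN A) N) :
    sliceLeft (normalExt μ) X = sliceLeft (vecFunctional ξ ξ) X := by
  have h := isNormal_normalExt_sub_and_eq_zero hξ
  have := h.1.sliceLeft_eq_zero h.2 hX
  rwa [sliceLeft_sub, sub_eq_zero] at this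

/-- The convolution of the vector states of `ξ` and `η` is implemented by the vector `ξ ⊗ η`. -/
theorem conv_apply_eq_inner {ν : StrongDual ℂ A} {η : UnivSpace A}
    (hξ : ∀ a, ⟪ξ, univRep A a ξ⟫_ℂ = μ a) (hη : ∀ a, ⟪η, univRep A a η⟫_ℂ = ν a)
    {Φ : A →⋆ₐ[ℂ] (HTensor (UnivSpace A) (UnivSpace A) →L[ℂ]
      HTensor (UnivSpace A) (UnivSpace A))}
    (hΦ : ∀ a, Φ a ∈ vnTensor (bidualVN A) (bidualVN A)) (a : A) :
    conv Φ μ ν a = ⟪ketLeft _ _ ξ η, Φ a (ketLeft _ _ ξ η)⟫_ℂ := by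
  change normalExt ν (sliceLeft (normalExt μ) (Φ a)) = _
  rw [normalExt_apply_of_mem hη (sliceLeft_mem _ (hΦ a)), sliceLeft_normalExt_of_mem hξ (hΦ a),
    inner_sliceLeft_vecFunctional]

theorem IsState.conv {ν : StrongDual ℂ A} (hμ : IsState μ) (hν : IsState ν)
    {Φ : A →⋆ₐ[ℂ] (HTensor (UnivSpace A) (UnivSpace A) →L[ℂ]
      HTensor (UnivSpace A) (UnivSpace A))}
    (hΦ : ∀ a, Φ a ∈ vnTensor (bidualVN A) (bidualVN A)) : IsState (conv Φ μ ν) := by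
  obtain ⟨ξ, hξ_norm, hξ⟩ := hμ.exists_vector
  obtain ⟨η, hη_norm, hη⟩ := hν.exists_vector
  refine ⟨?_, fun a ha => ?_⟩
  · rw [conv_apply_eq_inner hξ hη hΦ, map_one, one_apply_eq_self, inner_ketLeft,
      inner_self_eq_norm_sq_to_K, inner_self_eq_norm_sq_to_K, hξ_norm, hη_norm]
    simp
  · obtain ⟨b, rfl⟩ := CStarAlgebra.nonneg_iff_eq_star_mul_self.1 ha
    rw [conv_apply_eq_inner hξ hη hΦ, map_mul, map_star, ContinuousLinearMap.star_eq_adjoint,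
      mul_apply_eq_comp, ContinuousLinearMap.adjoint_inner_right,
      inner_self_eq_norm_sq_to_K]
    exact pow_nonneg (RCLike.ofReal_nonneg.2 (norm_nonneg _)) 2

end NormalExtension

/-! ### The operators of states on the Hilbert space of a C*-Eberlein algebra -/

namespace CStarEberlein

variable {A : Type u} [CStarAlgebra A] [PartialOrder A] [StarOrderedRing A]
  {H : Type v} [NormedAddCommGroup H] [InnerProductSpace ℂ H] [CompleteSpace H]
  (S : CStarEberlein A H)

/-- The operator `(μ ⊗ id)(V)` on `H`. -/
def coefficientOp (μ : StrongDual ℂ A) : H →L[ℂ] H := sliceLeft (normalExt μ) S.V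

theorem norm_coefficientOp_le {μ : StrongDual ℂ A} (hμ : IsState μ) :
    ‖S.coefficientOp μ‖ ≤ 1 := by
  obtain ⟨ξ, hξ_norm, hξ⟩ := hμ.exists_vector
  rw [coefficientOp, sliceLeft_normalExt_of_mem hξ S.V_mem]
  refine (norm_sliceLeft_vecFunctional_le ξ S.V).trans ?_
  rw [hξ_norm, one_pow, one_mul]
  exact S.norm_V_le

/-- The Fubini identity `⟨(μ ⊗ id)(V), ω⟩ = ⟨μ, (id ⊗ ω)(V)⟩`. -/
theorem apply_coefficientOp {μ : StrongDual ℂ A} (hμ : IsState μ)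
    {ω : StrongDual ℂ (H →L[ℂ] H)} {a : A} (ha : univRep A a = sliceRight ω S.V) :
    ω (S.coefficientOp μ) = μ a := by
  obtain ⟨ξ, -, hξ⟩ := hμ.exists_vector
  rw [← hξ, ha, inner_sliceRight, coefficientOp, sliceLeft_normalExt_of_mem hξ S.V_mem]
  congr 1
  ext α
  refine ext_inner_left ℂ fun β => ?_
  rw [inner_sliceLeft_vecFunctional, ContinuousLinearMap.comp_apply,
    ContinuousLinearMap.adjoint_inner_right]
  rfl

theorem exists_inner_coefficientOp_eq (α β : H) :
    ∃ a : A, ∀ μ, IsState μ → ⟪β, S.coefficientOp μ α⟫_ℂ = μ a := by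
  obtain ⟨a, ha⟩ := S.slice_mem _ (isNormal_vecFunctional α β)
  exact ⟨a, fun μ hμ => S.apply_coefficientOp hμ ha⟩

/-- Since the slices of `V` are dense in `A`, a state is determined by its operator on `H`. -/
theorem eq_of_coefficientOp_eq {μ ν : StrongDual ℂ A} (hμ : IsState μ) (hν : IsState ν)
    (h : S.coefficientOp μ = S.coefficientOp ν) : μ = ν := by
  refine DFunLike.coe_injective (Continuous.ext_on S.slice_dense μ.continuous ν.continuous ?_)
  rintro a ⟨ω, -, ha⟩
  rw [← S.apply_coefficientOp hμ ha, ← S.apply_coefficientOp hν ha, h]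

end CStarEberlein

/-! ### The state space -/

section StateSpace

variable (A : Type u) [CStarAlgebra A] [PartialOrder A] [StarOrderedRing A]

/-- The state space of `A` with its weak-* topology. -/
abbrev StateSpace : Type u := {μ : WeakDual ℂ A // IsState (WeakDual.toStrongDual μ)}

variable {A}

theorem IsState.norm_le_one {μ : StrongDual ℂ A} (hμ : IsState μ) : ‖μ‖ ≤ 1 := by
  obtain ⟨ξ, hξ_norm, hξ⟩ := hμ.exists_vector
  refine μ.opNorm_le_bound zero_le_one fun a => ?_
  rw [← hξ, one_mul]
  refine (norm_inner_le_norm _ _).trans ?_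
  rw [hξ_norm, one_mul]
  refine ((univRep A a).le_opNorm ξ).trans ?_
  rw [hξ_norm, mul_one]
  exact NonUnitalStarAlgHom.norm_apply_le (univRep A) a

theorem isCompact_setOf_isState :
    IsCompact {μ : WeakDual ℂ A | IsState (WeakDual.toStrongDual μ)} := by
  refine WeakDual.isCompact_of_bounded_of_closed
    ((WeakDual.isBounded_closedBall (0 : StrongDual ℂ A) 1).subset fun μ hμ => ?_) ?_
  · simpa using hμ.norm_le_one
  · have : {μ : WeakDual ℂ A | IsState (WeakDual.toStrongDual μ)} =
        {μ | μ 1 = 1} ∩ ⋂ (a : A) (_ : 0 ≤ a), {μ | 0 ≤ μ a} := by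
      ext μ
      simp only [Set.mem_inter_iff, Set.mem_iInter]
      rfl
    exact this ▸ (isClosed_eq (WeakDual.eval_continuous 1) continuous_const).inter
      (isClosed_iInter fun a => isClosed_iInter fun _ =>
        isClosed_le continuous_const (WeakDual.eval_continuous a))

instance : CompactSpace (StateSpace A) :=
  isCompact_iff_compactSpace.1 isCompact_setOf_isState

instance [Nontrivial A] : Nonempty (StateSpace A) :=
  let ⟨μ, hμ⟩ := exists_isState A
  ⟨⟨StrongDual.toWeakDual μ, hμ⟩⟩

omit [StarOrderedRing A] in
theorem IsState.midpoint {μ ν : StrongDual ℂ A} (hμ : IsState μ) (hν : IsState ν) :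
    IsState ((2⁻¹ : ℂ) • (μ + ν)) := by
  refine ⟨?_, fun a ha => ?_⟩
  · rw [smul_apply, add_apply, hμ.1, hν.1]
    norm_num
  · have h2 : (0 : ℂ) ≤ 2⁻¹ := by
      rw [show (2⁻¹ : ℂ) = ((2⁻¹ : ℝ) : ℂ) by norm_num]
      exact_mod_cast (by norm_num : (0 : ℝ) ≤ 2⁻¹)
    exact mul_nonneg h2 (add_nonneg (hμ.2 a ha) (hν.2 a ha))

end StateSpace

/-! ### Existence of the mean -/

/-- The operators `(μ ⊗ id)(V)`, for `μ` a state, form a compact convex semigroup of contractions.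
The mean is a state whose operator is fixed under multiplication from the left by all of them. -/
theorem CStarEberlein.exists_isLeftInvariantMean {A : Type u} [CStarAlgebra A] [PartialOrder A]
    [StarOrderedRing A] [Nontrivial A] {H : Type v} [NormedAddCommGroup H] [InnerProductSpace ℂ H]
    [CompleteSpace H] (S : CStarEberlein A H) :
    ∃ M : StrongDual ℂ A, S.IsLeftInvariantMean M := by
  let T : StateSpace A → H →L[ℂ] H := fun μ => S.coefficientOp (WeakDual.toStrongDual μ.1)
  obtain ⟨M, hM⟩ := exists_forall_mul_eq (T := T)
    (fun α β => by
      obtain ⟨a, ha⟩ := S.exists_inner_coefficientOp_eq α β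
      have : (fun μ => ⟪β, T μ α⟫_ℂ) = fun μ : StateSpace A => μ.1 a :=
        funext fun μ => ha _ μ.2
      rw [this]
      exact (WeakDual.eval_continuous a).comp continuous_subtype_val)
    (fun μ => S.norm_coefficientOp_le μ.2)
    (fun μ ν => ⟨⟨StrongDual.toWeakDual (conv S.Φ (WeakDual.toStrongDual μ.1)
      (WeakDual.toStrongDual ν.1)), μ.2.conv ν.2 S.Φ_mem⟩, S.slice_conv _ _⟩)
    (fun μ ν => by
      refine ⟨⟨StrongDual.toWeakDual ((2⁻¹ : ℂ) • (WeakDual.toStrongDual μ.1 +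
        WeakDual.toStrongDual ν.1)), μ.2.midpoint ν.2⟩, ?_⟩
      ext α
      refine ext_inner_left ℂ fun β => ?_
      obtain ⟨a, ha⟩ := S.exists_inner_coefficientOp_eq α β
      rw [smul_apply, add_apply, inner_smul_right, inner_add_right]
      refine (ha _ (μ.2.midpoint ν.2)).trans ?_
      rw [ha _ μ.2, ha _ ν.2]
      rfl)
  refine ⟨WeakDual.toStrongDual M.1, M.2, fun μ hμ a => ?_⟩
  have h : conv S.Φ μ (WeakDual.toStrongDual M.1) = WeakDual.toStrongDual M.1 :=
    S.eq_of_coefficientOp_eq (hμ.conv M.2 S.Φ_mem) M.2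
      ((S.slice_conv _ _).trans (hM ⟨StrongDual.toWeakDual μ, hμ⟩))
  exact DFunLike.congr_fun h a

end EberleinAlg

end

/-- Every non-zero unital C*-Eberlein algebra has a left invariant mean. -/
theorem mainTheorem1 {A : Type*} [CStarAlgebra A] [PartialOrder A] [StarOrderedRing A]
    [Nontrivial A] {H : Type*} [NormedAddCommGroup H] [InnerProductSpace ℂ H] [CompleteSpace H]
    (S : EberleinAlg.CStarEberlein A H) :
    ∃ M : StrongDual ℂ A, S.IsLeftInvariantMean M := by
  exact S.exists_isLeftInvariantMean
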